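/- Let $X$ be a real locally convex space with topological dual $X^*$, and let $X^*$ carry any locally convex topology compatible with the duality (its continuous linear functionals are exactly the evaluations $x^*\mapsto\langle x^*,y\rangle$, $y\in X$; e.g. the weak-$*$ topology). Write $\overline{\mathbb R}=\mathbb R\cup\{\pm\infty\}$. For $g:X\to\overline{\mathbb R}$ put $\operatorname{dom} g=\{g<+\infty\}$ and $[g\le 0]=\{y: g(y)\le 0\}$; $g$ is convex if its epigraph in $X\times\mathbb R$ is convex, and proper if $\operatorname{dom} g\neq\emptyset$ and $g>-\infty$ everywhere; $\bar g$ is the function whose epigraph is the closure of the epigraph of $g$. For $\varepsilon\ge 0$, let $\partial_\varepsilon g(x)=\{x^*\in X^*:\langle x^*,y-x\rangle\le g(y)-g(x)+\varepsilon\ \ \forall y\in X\}$ if $g(x)\in\mathbb R$, and $\partial_\varepsilon g(x)=\emptyset$ otherwise. For $A\subset X$, let $\mathrm N^\varepsilon_A(x)=\partial_\varepsilon \mathrm I_A(x)$, where $\mathrm I_A$ is $0$ on $A$ and $+\infty$ off $A$, and $\mathrm N_A(x)=\mathrm N^0_A(x)$. The recession cone of a nonempty closed convex set $C$ is $[C]_\infty=\bigcap_{r>0}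 r(C-c)$, for any $c\in C$, and $[\emptyset]_\infty=\{0\}$; $\overline{\operatorname{co}}$ denotes the closed convex hull. Let $f_t:X\to\overline{\mathbb R}$, $t\in T$, be an arbitrary family of convex functions, let $f=\sup_{t\in T}f_t$, let $\mathcal P=\{t\in T:\bar f_t \text{ is proper}\}$, and assume that $$\overline{[f\le 0]}=\bigcap_{t\in T}[\bar f_t\le 0].$$ Let $x\in[f\le 0]$ with $f(x)\in\mathbb R$, and for $\varepsilon>0$ set $$G_\varepsilon=\Big(\bigcup_{s>0}\ \bigcup_{t\in\mathcal P,\ s f_t(x)\ge-\varepsilon}\partial_\varepsilon(s f_t)(x)\Big)\cup\Big(\bigcup_{t\in T\setminus\mathcal P}\mathrm N^\varepsilon_{\operatorname{dom} f_t}(x)\Big).$$ Then $$\mathrm N_{[f\le 0]}(x)=\big[\overline{\operatorname{co}}\,(G_\varepsilon)\big]_\infty\quad\text{for every }\varepsilon>0,$$ and consequently $$\mathrm N_{[f\le 0]}(x)=\bigcap_{\varepsilon>0}\overline{\operatorname{co}}\,(G_\varepsilon).$$ -/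

import Mathlib

open Topology Pointwise

noncomputable section

namespace SublevelNormal

section ExtendedRealFunctions

variable {X : Type*}

/-- The (effective) domain of an extended-real-valued function. -/
def effDom (f : X → EReal) : Set X := {x | f x < ⊤}

/-- The epigraph of `f`, as a subset of `X × ℝ`. -/
def epi (f : X → EReal) : Set (X × ℝ) := {p | f p.1 ≤ (p.2 : EReal)}

/-- The sublevel set `[f ≤ 0]`. -/
def sublevelZero (f : X → EReal) : Set X := {x | f x ≤ 0}

/-- `f` is proper: its domain is nonempty and `f` never takes the value `-∞`. -/
def IsProper (f : X → EReal) : Prop := (effDom f).Nonempty ∧ ∀ x, ⊥ < f x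

/-- `f` is convex: its epigraph is convex in `X × ℝ`. -/
def IsConvex [AddCommGroup X] [Module ℝ X] (f : X → EReal) : Prop := Convex ℝ (epi f)

/-- The closed hull of `f`, the function whose epigraph is the closure of the epigraph of `f`
(see `epi_closedHull`). -/
def closedHull [TopologicalSpace X] (f : X → EReal) (x : X) : EReal :=
  sInf ((fun r : ℝ => (r : EReal)) '' {r : ℝ | (x, r) ∈ closure (epi f)})

/-- The indicator function of a set: `0` on `A` and `+∞` outside `A`. -/
def indicatorTop (A : Set X) (x : X) : EReal :=
  open Classical in if x ∈ A then 0 else ⊤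

theorem epi_closedHull [TopologicalSpace X] (f : X → EReal) :
    epi (closedHull f) = closure (epi f) := by
  have up : ∀ (x : X) (r s : ℝ), (x, r) ∈ closure (epi f) → r ≤ s →
      (x, s) ∈ closure (epi f) := by
    intro x r s hr hrs
    have hc : Continuous (fun p : X × ℝ => (p.1, p.2 + (s - r))) := by fun_prop
    have hm : Set.MapsTo (fun p : X × ℝ => (p.1, p.2 + (s - r))) (epi f) (epi f) := by
      intro p hp
      refine le_trans (show f p.1 ≤ (p.2 : EReal) from hp) ?_
      exact_mod_cast (by linarith : p.2 ≤ p.2 + (s - r))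
    have := hm.closure hc hr
    simpa using this
  ext ⟨x, r⟩
  constructor
  · intro h
    have h' : closedHull f x ≤ (r : EReal) := h
    have key : ∀ s : ℝ, r < s → (x, s) ∈ closure (epi f) := by
      intro s hs
      have hlt : closedHull f x < (s : EReal) := lt_of_le_of_lt h' (by exact_mod_cast hs)
      obtain ⟨_, ⟨q, hq, rfl⟩, hqs⟩ := sInf_lt_iff.mp hlt
      exact up x q s hq (EReal.coe_le_coe_iff.mp hqs.le)
    have hc : Continuous (fun s : ℝ => (x, s)) := by fun_prop
    have hcl : IsClosed {s : ℝ | (x, s) ∈ closure (epi f)} := isClosed_closure.preimage hc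
    have hsub : closure (Set.Ioi r) ⊆ {s : ℝ | (x, s) ∈ closure (epi f)} :=
      closure_minimal (fun s hs => key s hs) hcl
    rw [closure_Ioi] at hsub
    exact hsub Set.self_mem_Ici
  · intro h
    exact sInf_le (Set.mem_image_of_mem (fun r : ℝ => (r : EReal)) h)

end ExtendedRealFunctions

section Recession

variable {E : Type*} [AddCommGroup E] [Module ℝ E]

/-- The recession cone `⋂_{r > 0} r (A - a)` of a closed convex set `A`, which for nonempty `A`
does not depend on `a ∈ A` (see `recessionCone_eq`); by convention it is `{0}` for empty `A`. -/
def recessionCone (A : Set E) : Set E :=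
  {v | (A = ∅ → v = 0) ∧ ∀ a ∈ A, ∀ r : ℝ, 0 < r → v ∈ r • (A - {a})}

theorem mem_smul_sub_iff {A : Set E} {a v : E} {r : ℝ} (hr : 0 < r) :
    v ∈ r • (A - {a}) ↔ a + r⁻¹ • v ∈ A := by
  rw [Set.mem_smul_set_iff_inv_smul_mem₀ hr.ne', Set.sub_singleton, Set.mem_image]
  constructor
  · rintro ⟨b, hb, h⟩
    rw [← h, add_sub_cancel]
    exact hb
  · intro h
    exact ⟨_, h, by abel⟩

theorem recessionCone_eq [TopologicalSpace E] [IsTopologicalAddGroup E] [ContinuousSMul ℝ E]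
    {A : Set E} (hA : IsClosed A) (hc : Convex ℝ A) {a : E} (ha : a ∈ A) :
    recessionCone A = ⋂ r : ℝ, ⋂ _ : 0 < r, r • (A - {a}) := by
  ext v
  simp only [Set.mem_iInter]
  constructor
  · exact fun h => h.2 a ha
  · intro h
    refine ⟨fun h0 => absurd ha (by simp [h0]), fun b hb r hr => ?_⟩
    rw [mem_smul_sub_iff hr]
    have hlim : Filter.Tendsto (fun u : ℝ => (1 - u) • b + u • a + r⁻¹ • v) (𝓝[>] 0)
        (𝓝 ((1 - (0 : ℝ)) • b + (0 : ℝ) • a + r⁻¹ • v)) := by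
      have hcont : Continuous (fun u : ℝ => (1 - u) • b + u • a + r⁻¹ • v) := by fun_prop
      exact (hcont.tendsto 0).mono_left nhdsWithin_le_nhds
    have hmem : ∀ᶠ u : ℝ in 𝓝[>] 0, (1 - u) • b + u • a + r⁻¹ • v ∈ A := by
      filter_upwards [Ioo_mem_nhdsGT (zero_lt_one' ℝ)] with u hu
      have h1 := (mem_smul_sub_iff (mul_pos hr hu.1)).mp (h (r * u) (mul_pos hr hu.1))
      have h2 := hc hb h1 (sub_nonneg.mpr hu.2.le) hu.1.le (by ring)
      convert h2 using 1
      rw [smul_add, smul_smul, mul_inv, mul_comm u, mul_assoc, inv_mul_cancel₀ hu.1.ne', mul_one,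
        add_assoc]
    have := hA.mem_of_tendsto hlim hmem
    simpa using this

end Recession

section LocallyConvex

variable {X : Type*} [AddCommGroup X] [Module ℝ X] [TopologicalSpace X]

/-- A topology `τ` on the dual `X*` is compatible with the duality `⟨x*, x⟩ = x* x`: it is a locally
convex vector space topology whose continuous linear functionals are exactly the evaluations at
the points of `X`. The weak-* topology is an example. -/
structure IsCompatibleTopology (τ : TopologicalSpace (StrongDual ℝ X)) : Prop where
  isTopologicalAddGroup : @IsTopologicalAddGroup (StrongDual ℝ X) τ _
  continuousSMul : @ContinuousSMul ℝ (StrongDual ℝ X) _ _ τ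
  locallyConvexSpace : @LocallyConvexSpace ℝ (StrongDual ℝ X) _ _ _ _ τ
  continuous_iff : ∀ φ : StrongDual ℝ X →ₗ[ℝ] ℝ,
    Continuous[τ, inferInstance] φ ↔ ∃ x : X, ∀ p : StrongDual ℝ X, φ p = p x

/-- The `ε`-subdifferential of `f` at `x`, empty unless `f x` is a real number. -/
def epsSubdiff (ε : ℝ) (f : X → EReal) (x : X) : Set (StrongDual ℝ X) :=
  {p | f x ≠ ⊤ ∧ f x ≠ ⊥ ∧ ∀ y : X, ((p (y - x) : ℝ) : EReal) ≤ f y - f x + (ε : EReal)}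

/-- The `ε`-normal set to `A` at `x`. -/
def epsNormal (ε : ℝ) (A : Set X) (x : X) : Set (StrongDual ℝ X) :=
  epsSubdiff ε (indicatorTop A) x

/-- The normal cone to `A` at `x`. -/
def normalCone (A : Set X) (x : X) : Set (StrongDual ℝ X) := epsNormal 0 A x

variable {T : Type*}

/-- The set `𝒫` of the indices `t` for which the closed hull of `f t` is proper. -/
def properIndices (f : T → X → EReal) : Set T := {t | IsProper (closedHull (f t))}

/-- The set of the indices `t ∈ 𝒫` with `s * f t x ≥ -ε`. -/
def almostActive (f : T → X → EReal) (ε s : ℝ) (x : X) : Set T :=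
  {t | t ∈ properIndices f ∧ ((-ε : ℝ) : EReal) ≤ (s : EReal) * f t x}

/-- The union of the sets `∂_ε (s f_t)(x)`, over `s > 0` and `t ∈ 𝒫` with `s f_t(x) ≥ -ε`, and of
the sets `N^ε_{dom f_t}(x)`, over `t ∉ 𝒫`. -/
def generators (f : T → X → EReal) (ε : ℝ) (x : X) : Set (StrongDual ℝ X) :=
  (⋃ s : ℝ, ⋃ _ : 0 < s, ⋃ t ∈ almostActive f ε s x,
      epsSubdiff ε (fun y => (s : EReal) * f t y) x) ∪
    ⋃ t ∈ (properIndices f)ᶜ, epsNormal ε (effDom (f t)) x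

end LocallyConvex

end SublevelNormal

end

open Topology Pointwise

/-! For `y` in the sublevel set, every generator `p` satisfies `p (y - x) ≤ 2 * ε`
(`generators_le`), so a recession direction of the closed convex hull is nonpositive at `y - x`,
hence normal.

Conversely, the `τ`-continuous functionals are evaluations at points `y`, so by Hahn–Banach it
suffices that a normal `v` has `v y ≤ 0` whenever `y` is bounded above on the generators. Then `x +
r • y`, for a suitable `r > 0`, lies in every `[closedHull (f t) ≤ 0]`: otherwise a separating
functional, suitably scaled, would be a generator violating the bound
(`closedHull_nonpos_of_generators_le`). By `hcl` this point is in the closure of the sublevel set,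
where normality gives `r * v y ≤ 0`.

For the intersection formula, `0` lies in each closed hull, so each hull contains its recession
cone, and the bound `2 * ε` vanishes as `ε → 0`. -/

namespace SublevelNormal

/-! ### Recession cones and linear functionals. -/

section Separation

variable {E : Type*} [AddCommGroup E] [Module ℝ E] [TopologicalSpace E]

/-- Bounds on a continuous linear functional extend from a set to its closed convex hull. -/
theorem le_on_closure_convexHull {G : Set E} (φ : E →ₗ[ℝ] ℝ) (hφ : Continuous φ) {c : ℝ}
    (h : ∀ p ∈ G, φ p ≤ c) : ∀ p ∈ closure (convexHull ℝ G), φ p ≤ c := by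
  have hcl : IsClosed {p | φ p ≤ c} := isClosed_le hφ continuous_const
  have hco : Convex ℝ {p | φ p ≤ c} := convex_halfSpace_le φ.isLinear c
  exact closure_minimal (convexHull_min h hco) hcl

/-- A functional bounded above on `A` is nonpositive on the recession cone of `A`. -/
theorem recessionCone_nonpos {E : Type*} [AddCommGroup E] [Module ℝ E] {A : Set E}
    (hA : A.Nonempty) (φ : E →ₗ[ℝ] ℝ) {c : ℝ}
    (h : ∀ p ∈ A, φ p ≤ c) {v : E} (hv : v ∈ recessionCone A) : φ v ≤ 0 := by
  obtain ⟨a, ha⟩ := hA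
  by_contra! hpos
  -- Moving `n + 1` steps along `v` from `a` stays in `A` but pushes `φ` above `c`.
  obtain ⟨n, hn⟩ := exists_nat_gt ((c - φ a) / φ v)
  have hn' : (0 : ℝ) < n + 1 := by positivity
  have h1 := (mem_smul_sub_iff (inv_pos.mpr hn')).mp (hv.2 a ha _ (inv_pos.mpr hn'))
  have h2 := h _ h1
  rw [inv_inv, map_add, map_smul, smul_eq_mul] at h2
  rw [div_lt_iff₀ hpos] at hn
  nlinarith

/-- A vector `v` is a recession direction of the closed convex hull of `G` if every continuous
linear functional bounded above on `G` is nonpositive at `v`. -/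
theorem mem_recessionCone_closure_convexHull [IsTopologicalAddGroup E] [ContinuousSMul ℝ E]
    [LocallyConvexSpace ℝ E] {G : Set E} (hG : G.Nonempty) {v : E}
    (h : ∀ φ : E →ₗ[ℝ] ℝ, Continuous φ → ∀ c : ℝ, (∀ p ∈ G, φ p ≤ c) → φ v ≤ 0) :
    v ∈ recessionCone (closure (convexHull ℝ G)) := by
  have hne : (closure (convexHull ℝ G)).Nonempty := hG.convexHull.closure
  refine ⟨fun h0 => absurd h0 hne.ne_empty, fun a ha r hr => ?_⟩
  rw [mem_smul_sub_iff hr]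
  by_contra hmem
  obtain ⟨φ, u, h1, h2⟩ := geometric_hahn_banach_closed_point
    (convex_convexHull ℝ G).closure isClosed_closure hmem
  have h3 : φ v ≤ 0 := h φ.toLinearMap φ.continuous u
    fun p hp => (h1 p (subset_closure (subset_convexHull ℝ G hp))).le
  have h4 := h1 a ha
  rw [map_add, map_smul, smul_eq_mul] at h2
  nlinarith [mul_nonneg (inv_pos.mpr hr).le (neg_nonneg.mpr h3)]

/-- If `s • q ∈ G` for all small `s > 0`, then `0` is in the closure of `G`. -/
theorem zero_mem_closure_of_smul_mem [ContinuousSMul ℝ E] {G : Set E} {q : E} {δ : ℝ} (hδ : 0 < δ)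
    (h : ∀ s : ℝ, 0 < s → s ≤ δ → s • q ∈ G) : (0 : E) ∈ closure G := by
  have hc : Continuous (fun s : ℝ => s • q) := by fun_prop
  have ht : Filter.Tendsto (fun s : ℝ => s • q) (𝓝[>] 0) (𝓝 ((0 : ℝ) • q)) :=
    (hc.tendsto 0).mono_left nhdsWithin_le_nhds
  rw [zero_smul] at ht
  refine mem_closure_of_tendsto ht ?_
  filter_upwards [Ioo_mem_nhdsGT hδ] with s hs
  exact h s hs.1 hs.2.le

theorem mem_of_mem_recessionCone {E : Type*} [AddCommGroup E] [Module ℝ E] {A : Set E}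
    (h0 : (0 : E) ∈ A) {v : E} (hv : v ∈ recessionCone A) : v ∈ A := by
  have := (mem_smul_sub_iff one_pos).mp (hv.2 0 h0 1 one_pos)
  simpa using this

end Separation

/-! ### Closed hulls and affine minorants of convex functions. -/

section Functions

variable {X : Type*} [AddCommGroup X] [Module ℝ X] [TopologicalSpace X]

theorem mem_epsNormal_iff {A : Set X} {x : X} (hx : x ∈ A) {ε : ℝ} {p : StrongDual ℝ X} :
    p ∈ epsNormal ε A x ↔ ∀ y ∈ A, p (y - x) ≤ ε := by
  have hx0 : indicatorTop A x = 0 := by simp [indicatorTop, hx]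
  constructor
  · intro h y hy
    have := h.2.2 y
    rw [hx0] at this
    simp only [indicatorTop, hy, if_true, sub_zero, zero_add] at this
    exact_mod_cast this
  · intro h
    refine ⟨by simp [hx0], by simp [hx0], fun y => ?_⟩
    rw [hx0]
    by_cases hy : y ∈ A
    · simp only [indicatorTop, hy, if_true, sub_zero, zero_add]
      exact_mod_cast h y hy
    · simp [indicatorTop, hy]

theorem mem_normalCone_iff {A : Set X} {x : X} (hx : x ∈ A) {p : StrongDual ℝ X} :
    p ∈ normalCone A x ↔ ∀ y ∈ A, p (y - x) ≤ 0 :=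
  mem_epsNormal_iff hx

theorem closedHull_le_coe_iff {X : Type*} [TopologicalSpace X] {g : X → EReal} {z : X} {r : ℝ} :
    closedHull g z ≤ r ↔ (z, r) ∈ closure (epi g) := by
  rw [← epi_closedHull]; rfl

theorem closedHull_le {X : Type*} [TopologicalSpace X] (g : X → EReal) (z : X) : closedHull g z ≤ g z := by
  refine EReal.le_of_forall_lt_iff_le.mp fun r hr => ?_
  exact closedHull_le_coe_iff.mpr (subset_closure (show g z ≤ r from hr.le))

variable [IsTopologicalAddGroup X] [ContinuousSMul ℝ X]

/-- An improper closed convex function is nonpositive on the closure of its domain. -/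
theorem closedHull_nonpos_of_not_isProper {g : X → EReal} (hg : IsConvex g)
    (hdom : (effDom g).Nonempty) (hnp : ¬ IsProper (closedHull g)) {z : X}
    (hz : z ∈ closure (effDom g)) : closedHull g z ≤ 0 := by
  have hw : ∃ w, closedHull g w = ⊥ := by
    by_contra! hne
    obtain ⟨d, hd⟩ := hdom
    exact hnp ⟨⟨d, (closedHull_le g d).trans_lt hd⟩, fun w => bot_lt_iff_ne_bot.mpr (hne w)⟩
  obtain ⟨w, hw⟩ := hw
  have hwm : ∀ m : ℝ, (w, m) ∈ closure (epi g) := fun m =>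
    closedHull_le_coe_iff.mp (by simp [hw])
  have hconv : Convex ℝ (closure (epi g)) := Convex.closure hg
  have hD : effDom g ⊆ {z | (z, (0 : ℝ)) ∈ closure (epi g)} := by
    intro d hd
    obtain ⟨ρ, hρ, -⟩ := EReal.lt_iff_exists_real_btwn.mp (show g d < ⊤ from hd)
    have hdρ : (d, ρ) ∈ closure (epi g) := subset_closure (show g d ≤ ρ from hρ.le)
    have hc : Continuous (fun u : ℝ => (((1 - u) • d + u • w, (0 : ℝ)) : X × ℝ)) := by fun_prop
    have ht : Filter.Tendsto (fun u : ℝ => (((1 - u) • d + u • w, (0 : ℝ)) : X × ℝ)) (𝓝[>] 0)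
        (𝓝 (((1 - (0 : ℝ)) • d + (0 : ℝ) • w, (0 : ℝ)))) :=
      (hc.tendsto 0).mono_left nhdsWithin_le_nhds
    have hm : ((1 - (0 : ℝ)) • d + (0 : ℝ) • w, (0 : ℝ)) ∈ closure (epi g) := by
      refine isClosed_closure.mem_of_tendsto ht ?_
      filter_upwards [Ioo_mem_nhdsGT (zero_lt_one' ℝ)] with u hu
      -- This height over `w` makes the convex combination with `(d, ρ)` have height exactly `0`.
      have h2 := hconv hdρ (hwm (-(1 - u) * ρ / u)) (sub_nonneg.mpr hu.2.le) hu.1.le (by ring)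
      convert h2 using 1
      ext
      · simp
      · have := hu.1.ne'
        simp only [Prod.smul_mk, Prod.mk_add_mk, smul_eq_mul]
        field_simp
        ring
    simpa using hm
  have hcl : IsClosed {z : X | (z, (0 : ℝ)) ∈ closure (epi g)} :=
    isClosed_closure.preimage (by fun_prop)
  exact closedHull_le_coe_iff.mpr (closure_minimal hD hcl hz)

variable [LocallyConvexSpace ℝ X]

/-- Separation of a point from the closure of a convex epigraph. -/
theorem exists_separation_epi {g : X → EReal} (hg : IsConvex g) {z₀ : X} {c : ℝ}
    (h : (z₀, c) ∉ closure (epi g)) (hne : (epi g).Nonempty) :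
    ∃ (q : StrongDual ℝ X) (l u : ℝ), 0 ≤ l ∧ (∀ z ρ, (z, ρ) ∈ epi g → q z - l * ρ < u) ∧
      u < q z₀ - l * c := by
  obtain ⟨φ, u, h1, h2⟩ := geometric_hahn_banach_closed_point
    (Convex.closure hg) isClosed_closure h
  have hφ : ∀ z ρ, φ (z, ρ) = φ (z, 0) - (-φ (0, 1)) * ρ := by
    intro z ρ
    have : ((z, ρ) : X × ℝ) = (z, 0) + ρ • ((0, 1) : X × ℝ) := by ext <;> simp
    rw [this, map_add, map_smul, smul_eq_mul]
    ring
  have hep : ∀ z ρ, (z, ρ) ∈ epi g → φ (z, 0) - (-φ (0, 1)) * ρ < u := by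
    intro z ρ hz
    rw [← hφ]
    exact h1 _ (subset_closure hz)
  refine ⟨φ.comp (ContinuousLinearMap.inl ℝ X ℝ), -φ (0, 1), u, ?_, hep, ?_⟩
  -- Epigraphs are closed under moving upwards, so a negative `l` would make the functional
  -- unbounded on `epi g`.
  · by_contra! hl
    obtain ⟨⟨z, ρ⟩, hz⟩ := hne
    obtain ⟨n, hn⟩ := exists_nat_gt ((u - φ (z, 0) - φ (0, 1) * ρ) / φ (0, 1))
    have hup : (z, ρ + n) ∈ epi g := by
      refine le_trans (show g z ≤ ρ from hz) ?_
      exact_mod_cast (by simp : ρ ≤ ρ + n)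
    have := hep _ _ hup
    rw [div_lt_iff₀ (by linarith)] at hn
    linarith
  · rw [hφ] at h2
    exact h2

/-- A convex function whose closed hull is proper has a continuous affine minorant. -/
theorem exists_affine_minorant {g : X → EReal} (hg : IsConvex g) {x : X} (hx : g x ≤ 0)
    (hbot : ⊥ < closedHull g x) :
    ∃ (q : StrongDual ℝ X) (b : ℝ), 0 < b ∧ ∀ z ρ, (z, ρ) ∈ epi g → q (z - x) - ρ ≤ b := by
  obtain ⟨c, -, hc⟩ := EReal.lt_iff_exists_real_btwn.mp hbot
  have hmem : (x, c) ∉ closure (epi g) := fun h => (closedHull_le_coe_iff.mpr h).not_gt hc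
  have hx0 : (x, (0 : ℝ)) ∈ epi g := hx
  obtain ⟨q, l, u, hl, h1, h2⟩ := exists_separation_epi hg hmem ⟨_, hx0⟩
  have h3 := h1 _ _ hx0
  -- Both points lie over `x`, so no vertical hyperplane separates them.
  have hl0 : 0 < l := by
    refine hl.lt_of_ne ?_
    rintro rfl
    linarith
  refine ⟨l⁻¹ • q, max 1 (-c), by positivity, fun z ρ hz => le_max_of_le_right ?_⟩
  have h4 := h1 _ _ hz
  have h5 : q (z - x) ≤ l * (ρ - c) := by rw [map_sub]; linarith
  have h6 : l⁻¹ * q (z - x) ≤ ρ - c := by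
    rw [inv_mul_le_iff₀ hl0]; exact h5
  simp only [smul_apply, smul_eq_mul]
  linarith

/-- If the closed hull of `g` is proper and positive at `x + v`, then an affine minorant of `g`
witnesses this positivity. -/
theorem exists_affine_minorant_pos {g : X → EReal} (hg : IsConvex g) {x v : X} (hx : g x ≤ 0)
    (hbot : ⊥ < closedHull g x) (hv : 0 < closedHull g (x + v)) :
    ∃ (q : StrongDual ℝ X) (b : ℝ), 0 < b ∧ b < q v ∧
      ∀ z ρ, (z, ρ) ∈ epi g → q (z - x) - ρ ≤ b := by
  have hmem : (x + v, (0 : ℝ)) ∉ closure (epi g) :=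
    fun h => (closedHull_le_coe_iff.mpr h).not_gt hv
  have hx0 : (x, (0 : ℝ)) ∈ epi g := hx
  obtain ⟨q, l, u, hl, h1, h2⟩ := exists_separation_epi hg hmem ⟨_, hx0⟩
  have h3 := h1 _ _ hx0
  rw [map_add] at h2
  simp only [mul_zero, sub_zero] at h2 h3
  rcases hl.eq_or_lt with rfl | hl0
  -- The hyperplane is vertical: a large multiple of it, added to any affine minorant, keeps a
  -- minorant and makes it positive at `x + v`.
  · obtain ⟨q₀, b₀, hb₀, h0⟩ := exists_affine_minorant hg hx hbot
    have hgap : 0 < q v - (u - q x) := by linarith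
    obtain ⟨n, hn⟩ := exists_nat_gt ((b₀ - q₀ v) / (q v - (u - q x)))
    rw [div_lt_iff₀ hgap] at hn
    have hn0 : (0 : ℝ) ≤ n := n.cast_nonneg
    refine ⟨q₀ + (n : ℝ) • q, b₀ + n * (u - q x), ?_, ?_, fun z ρ hz => ?_⟩
    · nlinarith
    · simp only [add_apply, smul_apply, smul_eq_mul]
      linarith
    · have h4 := h1 _ _ hz
      have h5 := h0 _ _ hz
      have h6 : q (z - x) ≤ u - q x := by rw [map_sub]; linarith
      simp only [add_apply, smul_apply, smul_eq_mul]
      nlinarith [mul_le_mul_of_nonneg_left h6 hn0]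
  · refine ⟨l⁻¹ • q, l⁻¹ * (u - q x), ?_, ?_, fun z ρ hz => ?_⟩
    · exact mul_pos (inv_pos.mpr hl0) (by linarith)
    · simp only [smul_apply, smul_eq_mul]
      exact mul_lt_mul_of_pos_left (by linarith) (inv_pos.mpr hl0)
    · have h4 := h1 _ _ hz
      have h5 : q (z - x) ≤ l * (ρ + l⁻¹ * (u - q x)) := by
        rw [map_sub, mul_add, mul_inv_cancel_left₀ hl0.ne']
        linarith
      have h6 := (inv_mul_le_iff₀ hl0).mpr h5
      simp only [smul_apply, smul_eq_mul]
      linarith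

end Functions

/-! ### The generators and the constraints they encode. -/

section Generators

variable {X : Type*} [AddCommGroup X] [Module ℝ X] [TopologicalSpace X] {T : Type*}

/-- Scaled slopes of affine minorants of `f t` are generators. -/
theorem smul_mem_generators {f : T → X → EReal} {x : X} {t : T} (ht : t ∈ properIndices f)
    (hx : f t x ≤ 0) {q : StrongDual ℝ X} {b s ε : ℝ}
    (hq : ∀ z ρ, (z, ρ) ∈ epi (f t) → q (z - x) - ρ ≤ b) (hs : 0 < s) (hsb : s * b ≤ ε) :
    s • q ∈ generators f ε x := by
  have hbot : ∀ z, f t z ≠ ⊥ := fun z => ((ht.2 z).trans_le (closedHull_le (f t) z)).ne'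
  obtain ⟨a, ha⟩ : ∃ a : ℝ, f t x = a :=
    ⟨(f t x).toReal, (EReal.coe_toReal (hx.trans_lt EReal.zero_lt_top).ne (hbot x)).symm⟩
  have ha0 : a ≤ 0 := by rw [ha] at hx; exact_mod_cast hx
  -- The minorant at `z = x` yields `s * a ≥ -s * b ≥ -ε`, the almost-activity condition.
  have hab : -a ≤ b := by
    have := hq x a (show f t x ≤ a from ha.le)
    simpa using this
  refine Or.inl ?_
  simp only [Set.mem_iUnion]
  refine ⟨s, hs, t, ⟨ht, ?_⟩, ?_, ?_, fun z => ?_⟩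
  · rw [ha, ← EReal.coe_mul, EReal.coe_le_coe_iff]
    nlinarith
  · simp only [ha, ← EReal.coe_mul]; exact EReal.coe_ne_top _
  · simp only [ha, ← EReal.coe_mul]; exact EReal.coe_ne_bot _
  · simp only [ha, ← EReal.coe_mul]
    by_cases hz : f t z = ⊤
    · rw [hz, EReal.coe_mul_top_of_pos hs, EReal.top_sub_coe, EReal.top_add_coe]
      exact le_top
    · obtain ⟨c, hc⟩ : ∃ c : ℝ, f t z = c := ⟨(f t z).toReal, (EReal.coe_toReal hz (hbot z)).symm⟩
      have h1 := hq z c (show f t z ≤ c from hc.le)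
      rw [hc, ← EReal.coe_mul, ← EReal.coe_sub, ← EReal.coe_add, EReal.coe_le_coe_iff]
      simp only [smul_apply, smul_eq_mul]
      nlinarith

theorem mem_generators_of_not_isProper {f : T → X → EReal} {x : X} {t : T}
    (ht : t ∉ properIndices f) {p : StrongDual ℝ X} {ε : ℝ}
    (hp : p ∈ epsNormal ε (effDom (f t)) x) : p ∈ generators f ε x := by
  refine Or.inr ?_
  simp only [Set.mem_iUnion]
  exact ⟨t, ht, hp⟩

/-- Generators are bounded by `2 * ε` on the translated sublevel set. -/
theorem generators_le {f : T → X → EReal} {x y : X} (hx : ∀ t, f t x ≤ 0) (hy : ∀ t, f t y ≤ 0)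
    {ε : ℝ} (hε : 0 < ε) {p : StrongDual ℝ X} (hp : p ∈ generators f ε x) :
    p (y - x) ≤ 2 * ε := by
  rcases hp with hp | hp
  · simp only [Set.mem_iUnion] at hp
    obtain ⟨s, hs, t, ⟨ht, hact⟩, h1, h2, h3⟩ := hp
    have hbot : ∀ z, f t z ≠ ⊥ := fun z => ((ht.2 z).trans_le (closedHull_le (f t) z)).ne'
    have hreal : ∀ z, f t z ≤ 0 → ∃ a : ℝ, f t z = a ∧ a ≤ 0 := fun z hz => by
      have h := EReal.coe_toReal (hz.trans_lt EReal.zero_lt_top).ne (hbot z)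
      refine ⟨(f t z).toReal, h.symm, ?_⟩
      rw [← h] at hz
      exact_mod_cast hz
    obtain ⟨a, ha, ha0⟩ := hreal x (hx t)
    obtain ⟨c, hc, hc0⟩ := hreal y (hy t)
    have h4 := h3 y
    rw [ha, ← EReal.coe_mul, EReal.coe_le_coe_iff] at hact
    simp only [ha, hc, ← EReal.coe_mul, ← EReal.coe_sub, ← EReal.coe_add,
      EReal.coe_le_coe_iff] at h4
    -- One `ε` comes from the subdifferential, the other from `s * a ≥ -ε`; `s * c ≤ 0`.
    nlinarith
  · simp only [Set.mem_iUnion] at hp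
    obtain ⟨t, -, hp⟩ := hp
    have hxt : x ∈ effDom (f t) := (hx t).trans_lt EReal.zero_lt_top
    have := (mem_epsNormal_iff hxt).mp hp y ((hy t).trans_lt EReal.zero_lt_top)
    linarith

variable [IsTopologicalAddGroup X] [ContinuousSMul ℝ X] [LocallyConvexSpace ℝ X]

/-- If the generators are bounded by `ε / r` at `y`, then `x + r • y` satisfies the constraint
given by the closed hull of each `f t`. -/
theorem closedHull_nonpos_of_generators_le {f : T → X → EReal} (hf : ∀ t, IsConvex (f t)) {x : X}
    (hx : ∀ t, f t x ≤ 0) {ε r : ℝ} (hε : 0 < ε) (hr : 0 < r) {y : X}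
    (h : ∀ p ∈ generators f ε x, p y ≤ ε / r) (t : T) : closedHull (f t) (x + r • y) ≤ 0 := by
  -- Scaling by `ε / b` turns the gap `b < q (r • y)` into a value at `y` above `ε / r`.
  have hscale : ∀ (q : StrongDual ℝ X) (b : ℝ), 0 < b → b < q (r • y) →
      (ε / b) • q ∈ generators f ε x → False := by
    intro q b hb hbq hmem
    have h1 := h _ hmem
    simp only [smul_apply, map_smul, smul_eq_mul] at h1 hbq
    rw [div_mul_eq_mul_div, div_le_div_iff₀ hb hr] at h1
    nlinarith
  by_cases ht : t ∈ properIndices f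
  · by_contra! hpos
    obtain ⟨q, b, hb, hbq, hq⟩ := exists_affine_minorant_pos (hf t) (hx t) (ht.2 x) hpos
    exact hscale q b hb hbq
      (smul_mem_generators ht (hx t) hq (by positivity) (div_mul_cancel₀ ε hb.ne').le)
  · have hxt : x ∈ effDom (f t) := (hx t).trans_lt EReal.zero_lt_top
    refine closedHull_nonpos_of_not_isProper (hf t) ⟨x, hxt⟩ ht ?_
    by_contra hmem
    have hconv : Convex ℝ (effDom (f t)) := by
      have himg : effDom (f t) = LinearMap.fst ℝ X ℝ '' epi (f t) := by
        ext z
        constructor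
        · intro hz
          obtain ⟨ρ, hρ, -⟩ := EReal.lt_iff_exists_real_btwn.mp (show f t z < ⊤ from hz)
          exact ⟨(z, ρ), hρ.le, rfl⟩
        · rintro ⟨⟨z, ρ⟩, hz, rfl⟩
          exact (show f t z ≤ ρ from hz).trans_lt (EReal.coe_lt_top ρ)
      rw [himg]
      exact Convex.linear_image (hf t) _
    obtain ⟨q, u, h1, h2⟩ := geometric_hahn_banach_closed_point hconv.closure isClosed_closure hmem
    rw [map_add] at h2
    have h3 := h1 x (subset_closure hxt)
    have hb : 0 < u - q x := by linarith
    refine hscale q (u - q x) hb (by linarith) (mem_generators_of_not_isProper ht ?_)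
    refine (mem_epsNormal_iff hxt).mpr fun z hz => ?_
    have h4 := h1 z (subset_closure hz)
    rw [smul_apply, smul_eq_mul, div_mul_eq_mul_div, div_le_iff₀ hb, map_sub]
    exact mul_le_mul_of_nonneg_left (by linarith) hε.le

/-- Some functional has all its small positive multiples among the generators. -/
theorem exists_smul_mem_generators [Nonempty T] {f : T → X → EReal} (hf : ∀ t, IsConvex (f t))
    {x : X} (hx : ∀ t, f t x ≤ 0) {ε : ℝ} (hε : 0 < ε) :
    ∃ (q : StrongDual ℝ X) (δ : ℝ), 0 < δ ∧
      ∀ s : ℝ, 0 < s → s ≤ δ → s • q ∈ generators f ε x := by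
  obtain ⟨t⟩ : Nonempty T := inferInstance
  by_cases ht : t ∈ properIndices f
  · obtain ⟨q, b, hb, hq⟩ := exists_affine_minorant (hf t) (hx t) (ht.2 x)
    exact ⟨q, ε / b, by positivity, fun s hs hsδ =>
      smul_mem_generators ht (hx t) hq hs ((le_div_iff₀ hb).mp hsδ)⟩
  · refine ⟨0, 1, one_pos, fun s _ _ => mem_generators_of_not_isProper ht ?_⟩
    have hxt : x ∈ effDom (f t) := (hx t).trans_lt EReal.zero_lt_top
    refine (mem_epsNormal_iff hxt).mpr fun z _ => ?_
    simpa using hε.le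

/-- A functional in the normal cone is nonpositive wherever the generators are bounded above. -/
theorem normalCone_nonpos_of_generators_le {f : T → X → EReal} (hf : ∀ t, IsConvex (f t))
    (hcl : closure (sublevelZero (fun y => ⨆ t, f t y)) = ⋂ t, sublevelZero (closedHull (f t)))
    {x : X} (hx : x ∈ sublevelZero (fun y => ⨆ t, f t y)) {ε : ℝ} (hε : 0 < ε) {y : X} {c : ℝ}
    (h : ∀ p ∈ generators f ε x, p y ≤ c) {v : StrongDual ℝ X}
    (hv : v ∈ normalCone (sublevelZero (fun y => ⨆ t, f t y)) x) : v y ≤ 0 := by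
  -- With `r = ε / max c 1`, the bound `ε / r` is `max c 1 ≥ c`.
  have hc : 0 < max c 1 := by positivity
  have hr : 0 < ε / max c 1 := div_pos hε hc
  have hmem : x + (ε / max c 1) • y ∈ closure (sublevelZero (fun y => ⨆ t, f t y)) := by
    rw [hcl, Set.mem_iInter]
    refine closedHull_nonpos_of_generators_le hf (iSup_le_iff.mp hx) hε hr fun p hp => ?_
    rw [div_div_cancel₀ hε.ne']
    exact (h p hp).trans (le_max_left _ _)
  have hclosed : IsClosed {z | v (z - x) ≤ 0} :=
    isClosed_le (by fun_prop) continuous_const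
  have h1 : v (x + (ε / max c 1) • y - x) ≤ 0 :=
    closure_minimal ((mem_normalCone_iff hx).mp hv) hclosed hmem
  rw [add_sub_cancel_left, map_smul, smul_eq_mul] at h1
  exact nonpos_of_mul_nonpos_right h1 hr

end Generators

end SublevelNormal


/-! ### The two formulas for the normal cone. -/

theorem mainTheorem1 {X : Type*} [AddCommGroup X] [Module ℝ X] [TopologicalSpace X]
    [IsTopologicalAddGroup X] [ContinuousSMul ℝ X] [LocallyConvexSpace ℝ X]
    (τ : TopologicalSpace (StrongDual ℝ X)) (hτ : SublevelNormal.IsCompatibleTopology τ)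
    {T : Type*} (f : T → X → EReal) (hf : ∀ t, SublevelNormal.IsConvex (f t))
    (hcl : closure (SublevelNormal.sublevelZero (fun y => ⨆ t, f t y)) =
      ⋂ t, SublevelNormal.sublevelZero (SublevelNormal.closedHull (f t)))
    (x : X) (hx : x ∈ SublevelNormal.sublevelZero (fun y => ⨆ t, f t y))
    (hx_bot : (⨆ t, f t x) ≠ ⊥) (hx_top : (⨆ t, f t x) ≠ ⊤) :
    (∀ ε : ℝ, 0 < ε →
      SublevelNormal.normalCone (SublevelNormal.sublevelZero (fun y => ⨆ t, f t y)) x =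
        SublevelNormal.recessionCone
          (closure[τ] (convexHull ℝ (SublevelNormal.generators f ε x)))) ∧
    SublevelNormal.normalCone (SublevelNormal.sublevelZero (fun y => ⨆ t, f t y)) x =
      ⋂ ε : ℝ, ⋂ _ : 0 < ε,
        closure[τ] (convexHull ℝ (SublevelNormal.generators f ε x)) := by

  have hxt : ∀ t, f t x ≤ 0 := iSup_le_iff.mp hx
  -- An empty supremum would be `⊥`; without indices there would be no generators.
  have : Nonempty T := by
    by_contra hT
    rw [not_nonempty_iff] at hT
    exact hx_bot (iSup_of_empty _)
  let ev : X → StrongDual ℝ X →ₗ[ℝ] ℝ := fun y =>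
    { toFun := fun p => p y, map_add' := fun _ _ => rfl, map_smul' := fun _ _ => rfl }
  have hev : ∀ y, Continuous[τ, inferInstance] (ev y) := fun y =>
    (hτ.continuous_iff _).mpr ⟨y, fun _ => rfl⟩
  have hle : ∀ ε : ℝ, 0 < ε → ∀ y, (∀ t, f t y ≤ 0) →
      ∀ p ∈ closure[τ] (convexHull ℝ (SublevelNormal.generators f ε x)), p (y - x) ≤ 2 * ε :=
    fun ε hε y hy => @SublevelNormal.le_on_closure_convexHull _ _ _ τ _ (ev (y - x)) (hev _) _
      fun p hp => SublevelNormal.generators_le hxt hy hε hp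
  have h0 : ∀ ε : ℝ, 0 < ε →
      (0 : StrongDual ℝ X) ∈ closure[τ] (convexHull ℝ (SublevelNormal.generators f ε x)) := by
    intro ε hε
    obtain ⟨q, δ, hδ, hq⟩ := SublevelNormal.exists_smul_mem_generators hf hxt hε
    exact @closure_mono _ τ _ _ (subset_convexHull ℝ _) _
      (@SublevelNormal.zero_mem_closure_of_smul_mem _ _ _ τ hτ.continuousSMul _ _ _ hδ hq)
  have hrec : ∀ ε : ℝ, 0 < ε →
      SublevelNormal.normalCone (SublevelNormal.sublevelZero (fun y => ⨆ t, f t y)) x ⊆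
        SublevelNormal.recessionCone
          (closure[τ] (convexHull ℝ (SublevelNormal.generators f ε x))) := by
    intro ε hε v hv
    obtain ⟨q, δ, hδ, hq⟩ := SublevelNormal.exists_smul_mem_generators hf hxt hε
    refine @SublevelNormal.mem_recessionCone_closure_convexHull _ _ _ τ hτ.isTopologicalAddGroup
      hτ.continuousSMul hτ.locallyConvexSpace _ ⟨_, hq δ hδ le_rfl⟩ _ fun φ hφ c hc => ?_
    obtain ⟨y, hy⟩ := (hτ.continuous_iff φ).mp hφ
    rw [hy]
    exact SublevelNormal.normalCone_nonpos_of_generators_le hf hcl hx hε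
      (fun p hp => (hy p).symm.trans_le (hc p hp)) hv
  refine ⟨fun ε hε => (hrec ε hε).antisymm fun v hv => ?_, Set.Subset.antisymm ?_ ?_⟩
  · refine (SublevelNormal.mem_normalCone_iff hx).mpr fun y hy => ?_
    exact SublevelNormal.recessionCone_nonpos ⟨0, h0 ε hε⟩ (ev (y - x))
      (hle ε hε y (iSup_le_iff.mp hy)) hv
  · intro v hv
    simp only [Set.mem_iInter]
    exact fun ε hε => SublevelNormal.mem_of_mem_recessionCone (h0 ε hε) (hrec ε hε hv)
  · intro v hv
    simp only [Set.mem_iInter] at hv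
    refine (SublevelNormal.mem_normalCone_iff hx).mpr fun y hy => ?_
    refine le_of_forall_pos_le_add fun δ hδ => ?_
    have := hle (δ / 2) (half_pos hδ) y (iSup_le_iff.mp hy) v (hv _ (half_pos hδ))
    linarith
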